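/- Let $d\ge 1$, let $S^{d-1}$ be the unit sphere of $\mathbb{R}^d$ with the Euclidean norm, let $\alpha\in(0,2)$, let $\sigma$ be a non-zero finite Borel measure on $S^{d-1}$, and let $f:S^{d-1}\to\mathbb{R}$ be a measurable function with $\gamma:=\sup_{\xi\in S^{d-1}}f(\xi)<\alpha+1$. Let $\mu$ be a Lamperti stable distribution on $\mathbb{R}^d$ with characteristics $(\alpha,f,\sigma)$, that is, an infinitely divisible probability measure without Gaussian component (and with arbitrary drift) whose Lévy measure is $$\nu_\sigma^{\alpha,f}(B)=\int_{S^{d-1}}\sigma(\mathrm{d}\xi)\int_0^\infty \mathbf{1}_B(r\xi)\,e^{rf(\xi)}(e^r-1)^{-(\alpha+1)}\,\mathrm{d}r,\qquad B\in\mathcal{B}(\mathbb{R}^d\setminus\{0\}).$$ Then: 1. $\int_{\mathbb{R}^d}\|x\|^p\,\mu(\mathrm{d}x)<\infty$ for all real $p>0$. 2. If $\zeta\in\mathbb{R}$ and $\zeta<\alpha+1-\gamma$, then $\int_{\mathbb{R}^d}e^{\zeta\|x\|}\,\mu(\mathrm{d}x)<\infty$. 3. If $f\equiv\kappa$ for a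 constant $\kappa$ (so that $\kappa<\alpha+1$), then for every $\zeta\in\mathbb{R}$, $\int_{\mathbb{R}^d}e^{\zeta\|x\|}\,\mu(\mathrm{d}x)<\infty$ if and only if $\zeta<\alpha+1-\kappa$. -/

import Mathlib

namespace LampertiStable

/-- `n`-fold convolution power of a measure. -/
noncomputable def convPow {E : Type*} [AddMonoid E] [MeasurableSpace E]
    (ρ : MeasureTheory.Measure E) : ℕ → MeasureTheory.Measure E
  | 0 => MeasureTheory.Measure.dirac 0
  | n + 1 => (convPow ρ n).conv ρ

/-- A probability measure is infinitely divisible if for every `n ≥ 1` it is the `n`-fold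
convolution power of some probability measure. -/
def IsInfinitelyDivisible {E : Type*} [AddMonoid E] [MeasurableSpace E]
    (μ : MeasureTheory.Measure E) : Prop :=
  MeasureTheory.IsProbabilityMeasure μ ∧
    ∀ n : ℕ, 1 ≤ n → ∃ ρ : MeasureTheory.Measure E,
      MeasureTheory.IsProbabilityMeasure ρ ∧ convPow ρ n = μ

/-- A Lévy measure on `ℝ^d ∖ {0}`, viewed as a measure on `ℝ^d` without mass at `0`. -/
structure IsLevyMeasure {d : ℕ}
    (ν : MeasureTheory.Measure (EuclideanSpace ℝ (Fin d))) : Prop where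
  zero_null : ν {0} = 0
  lintegral_lt_top : ∫⁻ x, ENNReal.ofReal (min 1 (‖x‖ ^ 2)) ∂ν < ⊤

/-- The Lévy–Khintchine exponent with drift `b`, Gaussian covariance operator `A` and
Lévy measure `ν`. -/
noncomputable def levyExponent {d : ℕ} (b : EuclideanSpace ℝ (Fin d))
    (A : EuclideanSpace ℝ (Fin d) →L[ℝ] EuclideanSpace ℝ (Fin d))
    (ν : MeasureTheory.Measure (EuclideanSpace ℝ (Fin d)))
    (y : EuclideanSpace ℝ (Fin d)) : ℂ :=
  Complex.I * (inner ℝ y b : ℝ) - (1 / 2 : ℂ) * (inner ℝ y (A y) : ℝ) +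
    ∫ x, (Complex.exp (Complex.I * (inner ℝ y x : ℝ)) - 1 -
      Complex.I * (inner ℝ y x : ℝ) *
        (Metric.ball (0 : EuclideanSpace ℝ (Fin d)) 1).indicator (fun _ => (1 : ℂ)) x) ∂ν

/-- `μ` is infinitely divisible with generating triplet `(A, ν, b)`: Gaussian covariance `A`,
Lévy measure `ν`, drift `b` (relative to truncation on the open unit ball). -/
structure HasLevyTriplet {d : ℕ} (μ : MeasureTheory.Measure (EuclideanSpace ℝ (Fin d)))
    (A : EuclideanSpace ℝ (Fin d) →L[ℝ] EuclideanSpace ℝ (Fin d))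
    (ν : MeasureTheory.Measure (EuclideanSpace ℝ (Fin d)))
    (b : EuclideanSpace ℝ (Fin d)) : Prop where
  infinitelyDivisible : IsInfinitelyDivisible μ
  isPositive : A.IsPositive
  isLevyMeasure : IsLevyMeasure ν
  charFun_eq : ∀ y, MeasureTheory.charFun μ y = Complex.exp (levyExponent b A ν y)

/-- The radial density `r ↦ e^{r f(ξ)} (e^r - 1)^{-(α+1)}`, as a function of `(ξ, r)`. -/
noncomputable def density {S : Type*} (α : ℝ) (f : S → ℝ) (p : S × ℝ) : ENNReal :=
  ENNReal.ofReal (Real.exp (p.2 * f p.1) * (Real.exp p.2 - 1) ^ (-(α + 1)))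

/-- The measure `B ↦ ∫_{S^{d-1}} σ(dξ) ∫_0^∞ 1_B(r ξ) e^{r f(ξ)} (e^r - 1)^{-(α+1)} dr`, as the
image in `ℝ^d` under `(ξ, r) ↦ r ξ` of a measure with density on `S^{d-1} × (0, ∞)`. -/
noncomputable def levyMeasure {d : ℕ} (α : ℝ)
    (f : Metric.sphere (0 : EuclideanSpace ℝ (Fin d)) 1 → ℝ)
    (σ : MeasureTheory.Measure (Metric.sphere (0 : EuclideanSpace ℝ (Fin d)) 1)) :
    MeasureTheory.Measure (EuclideanSpace ℝ (Fin d)) :=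
  ((σ.prod (MeasureTheory.volume.restrict (Set.Ioi (0 : ℝ)))).withDensity (density α f)).map
    (fun p => p.2 • (p.1 : EuclideanSpace ℝ (Fin d)))

theorem measurable_density {S : Type*} [MeasurableSpace S] (α : ℝ) {f : S → ℝ}
    (hf : Measurable f) : Measurable (density α f) := by
  unfold density
  fun_prop

/-- Integration in polar coordinates against `levyMeasure`. -/
theorem lintegral_levyMeasure {d : ℕ} (α : ℝ)
    {f : Metric.sphere (0 : EuclideanSpace ℝ (Fin d)) 1 → ℝ} (hf : Measurable f)
    (σ : MeasureTheory.Measure (Metric.sphere (0 : EuclideanSpace ℝ (Fin d)) 1))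
    {g : EuclideanSpace ℝ (Fin d) → ENNReal} (hg : Measurable g) :
    ∫⁻ x, g x ∂(levyMeasure α f σ) =
      ∫⁻ ξ, (∫⁻ r in Set.Ioi (0 : ℝ), g (r • (ξ : EuclideanSpace ℝ (Fin d))) *
        ENNReal.ofReal (Real.exp (r * f ξ) * (Real.exp r - 1) ^ (-(α + 1)))) ∂σ := by
  have hd := measurable_density α hf
  have hm : Measurable (fun p : Metric.sphere (0 : EuclideanSpace ℝ (Fin d)) 1 × ℝ =>
      p.2 • (p.1 : EuclideanSpace ℝ (Fin d))) := by fun_prop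
  have hgm : Measurable (fun p : Metric.sphere (0 : EuclideanSpace ℝ (Fin d)) 1 × ℝ =>
      g (p.2 • (p.1 : EuclideanSpace ℝ (Fin d)))) := hg.comp hm
  rw [levyMeasure, MeasureTheory.lintegral_map hg hm,
    MeasureTheory.lintegral_withDensity_eq_lintegral_mul _ hd hgm,
    MeasureTheory.lintegral_prod _ (hd.mul hgm).aemeasurable]
  refine MeasureTheory.lintegral_congr fun ξ => MeasureTheory.lintegral_congr fun r => ?_
  simp only [Pi.mul_apply, density]
  rw [mul_comm]

/-- Under the standing assumptions on `(α, f, σ)`, `levyMeasure α f σ` is a Lévy measure. -/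
theorem isLevyMeasure_levyMeasure {d : ℕ} {α : ℝ} (h2 : α < 2) (h0 : 0 < α)
    {f : Metric.sphere (0 : EuclideanSpace ℝ (Fin d)) 1 → ℝ} (hf : Measurable f)
    (hb : BddAbove (Set.range f)) (hs : (⨆ ξ, f ξ) < α + 1)
    (σ : MeasureTheory.Measure (Metric.sphere (0 : EuclideanSpace ℝ (Fin d)) 1))
    [MeasureTheory.IsFiniteMeasure σ] : IsLevyMeasure (levyMeasure α f σ) := by
  constructor
  · have h := lintegral_levyMeasure α hf σ (g := Set.indicator {0} 1)
      (measurable_one.indicator (measurableSet_singleton 0))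
    rw [MeasureTheory.lintegral_indicator_one (measurableSet_singleton 0)] at h
    rw [h, MeasureTheory.lintegral_eq_zero_of_ae_eq_zero]
    refine Filter.Eventually.of_forall fun ξ => ?_
    refine MeasureTheory.setLIntegral_eq_zero measurableSet_Ioi fun r hr => ?_
    have hξ : (ξ : EuclideanSpace ℝ (Fin d)) ≠ 0 := ne_zero_of_mem_unit_sphere ξ
    have : r • (ξ : EuclideanSpace ℝ (Fin d)) ∉ ({0} : Set (EuclideanSpace ℝ (Fin d))) := by
      simp [hξ, (Set.mem_Ioi.1 hr).ne']
    simp [this]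
  · rw [lintegral_levyMeasure α hf σ (by fun_prop)]
    set γ := ⨆ ξ, f ξ with hγ
    set c : ℝ := (1 - Real.exp (-1)) ^ (-(α + 1)) with hc
    have hc1 : 0 < 1 - Real.exp (-1) := by simp
    have hA : MeasureTheory.IntegrableOn (fun r : ℝ => Real.exp |γ| * r ^ (1 - α))
        (Set.Ioc 0 1) :=
      (((intervalIntegrable_iff_integrableOn_Ioc_of_le zero_le_one).1
        (intervalIntegral.intervalIntegrable_rpow' (by linarith))).const_mul _)
    have hB : MeasureTheory.IntegrableOn (fun r : ℝ => c * Real.exp (-(α + 1 - γ) * r))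
        (Set.Ioi 1) := (integrableOn_exp_mul_Ioi (by linarith) 1).const_mul _
    set K : ENNReal :=
      (∫⁻ r in Set.Ioc (0 : ℝ) 1, ENNReal.ofReal (Real.exp |γ| * r ^ (1 - α))) +
      ∫⁻ r in Set.Ioi (1 : ℝ), ENNReal.ofReal (c * Real.exp (-(α + 1 - γ) * r)) with hK
    have hKt : K < ⊤ := ENNReal.add_lt_top.2 ⟨hA.setLIntegral_lt_top, hB.setLIntegral_lt_top⟩
    refine lt_of_le_of_lt (MeasureTheory.lintegral_mono (g := fun _ => K) fun ξ => ?_) ?_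
    · have hfξ : f ξ ≤ γ := le_ciSup hb ξ
      have hn : ‖(ξ : EuclideanSpace ℝ (Fin d))‖ = 1 := norm_eq_of_mem_sphere ξ
      rw [← Set.Ioc_union_Ioi_eq_Ioi (zero_le_one' ℝ), MeasureTheory.lintegral_union
        measurableSet_Ioi (Set.Ioc_disjoint_Ioi le_rfl), hK]
      refine add_le_add (MeasureTheory.setLIntegral_mono' measurableSet_Ioc fun r hr => ?_)
        (MeasureTheory.setLIntegral_mono' measurableSet_Ioi fun r hr => ?_)
      · have hr0 : 0 < r := hr.1
        have hr1 : r ≤ 1 := hr.2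
        rw [← ENNReal.ofReal_mul (by positivity)]
        refine ENNReal.ofReal_le_ofReal ?_
        have e1 : Real.exp (r * f ξ) ≤ Real.exp |γ| := by
          apply Real.exp_le_exp.2
          calc r * f ξ ≤ r * |γ| := by gcongr; exact hfξ.trans (le_abs_self _)
            _ ≤ 1 * |γ| := by gcongr
            _ = |γ| := one_mul _
        have hre : r ≤ Real.exp r - 1 := by linarith [Real.add_one_le_exp r]
        have e2 : (Real.exp r - 1) ^ (-(α + 1)) ≤ r ^ (-(α + 1)) :=
          Real.rpow_le_rpow_of_nonpos hr0 hre (by linarith)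
        have e3 : min 1 (‖r • (ξ : EuclideanSpace ℝ (Fin d))‖ ^ 2) ≤ r ^ (2 : ℝ) := by
          rw [norm_smul, hn, mul_one, Real.norm_eq_abs, sq_abs, Real.rpow_two]
          exact min_le_right _ _
        have e0 : 0 ≤ (Real.exp r - 1) ^ (-(α + 1)) := Real.rpow_nonneg (by linarith) _
        calc _ ≤ r ^ (2 : ℝ) * (Real.exp |γ| * r ^ (-(α + 1))) := by gcongr
          _ = Real.exp |γ| * (r ^ (2 : ℝ) * r ^ (-(α + 1))) := by ring
          _ = Real.exp |γ| * r ^ (1 - α) := by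
            rw [← Real.rpow_add hr0]; ring_nf
      · have hr1 : 1 < r := hr
        rw [← ENNReal.ofReal_mul (by positivity)]
        refine ENNReal.ofReal_le_ofReal ?_
        have e1 : Real.exp (r * f ξ) ≤ Real.exp (r * γ) := by
          apply Real.exp_le_exp.2
          gcongr
        have hre : (1 - Real.exp (-1)) * Real.exp r ≤ Real.exp r - 1 := by
          have : 1 ≤ Real.exp (-1) * Real.exp r := by
            rw [← Real.exp_add]; exact Real.one_le_exp (by linarith)
          linarith
        have e2 : (Real.exp r - 1) ^ (-(α + 1)) ≤ c * Real.exp (r * (-(α + 1))) := by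
          rw [hc, Real.exp_mul, ← Real.mul_rpow hc1.le (Real.exp_pos r).le]
          exact Real.rpow_le_rpow_of_nonpos (by positivity) hre (by linarith)
        have e0 : 0 ≤ (Real.exp r - 1) ^ (-(α + 1)) :=
          Real.rpow_nonneg (by linarith [Real.add_one_le_exp r]) _
        calc _ ≤ 1 * (Real.exp (r * γ) * (c * Real.exp (r * (-(α + 1))))) := by
              gcongr; exact min_le_left _ _
          _ = c * (Real.exp (r * γ) * Real.exp (r * (-(α + 1)))) := by ring
          _ = c * Real.exp (-(α + 1 - γ) * r) := by rw [← Real.exp_add]; ring_nf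
    · rw [MeasureTheory.lintegral_const]
      exact ENNReal.mul_lt_top hKt (MeasureTheory.measure_lt_top σ _)

/-- `μ` is a Lamperti stable distribution on `ℝ^d` with characteristics `(α, f, σ)`: it is
infinitely divisible without Gaussian component and its Lévy measure is `levyMeasure α f σ`,
where `α ∈ (0, 2)`, `σ` is a non-zero finite measure on the unit sphere and `f` is a measurable
function on the unit sphere that is bounded above with `sup f < α + 1`. -/
structure IsLampertiStable {d : ℕ} (α : ℝ)
    (f : Metric.sphere (0 : EuclideanSpace ℝ (Fin d)) 1 → ℝ)
    (σ : MeasureTheory.Measure (Metric.sphere (0 : EuclideanSpace ℝ (Fin d)) 1))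
    (μ : MeasureTheory.Measure (EuclideanSpace ℝ (Fin d))) : Prop where
  index_pos : 0 < α
  index_lt_two : α < 2
  isFiniteMeasure : MeasureTheory.IsFiniteMeasure σ
  ne_zero : σ ≠ 0
  measurable : Measurable f
  bddAbove : BddAbove (Set.range f)
  iSup_lt : (⨆ ξ, f ξ) < α + 1
  hasLevyTriplet : ∃ b : EuclideanSpace ℝ (Fin d), HasLevyTriplet μ 0 (levyMeasure α f σ) b

end LampertiStable

/-!
An infinitely divisible law `μ` without Gaussian part has `∫ e^{ζ‖x‖} dμ < ∞` (for `ζ ≥ 0`) exactly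
when `∫_{‖x‖ ≥ 1} e^{ζ‖x‖} dν < ∞`, where `ν` is its Lévy measure
(`HasLevyTriplet.lintegral_exp_norm_lt_top_iff`). For a Lamperti stable law, polar coordinates turn
the second integral into an integral of `e^{(ζ + f(ξ)) r} (e^r - 1)^{-(α+1)}` over `r ≥ 1`, which is
comparable to `e^{(ζ + f(ξ) - α - 1) r}`. It converges, uniformly in `ξ`, when `ζ < α + 1 - sup f`,
and for `f = κ` it diverges when `ζ ≥ α + 1 - κ`. The power moments are dominated by a small
exponential moment.

To prove the equivalence, `μ` is approximated by the convolution `truncatedLaw b ν n` of two laws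
built from compound Poisson distributions: `smallJumps b ν n`, which carries the compensated jumps
of size in `[1/(n+1), 1)`, and the compound Poisson law of the jumps of size at least `1`. The
characteristic functions converge to that of `μ`, so Lévy's convergence theorem gives weak
convergence. Three estimates carry the limit over to `μ`:

* the small jumps have every exponential moment, uniformly in `n`, because
  `|e^t - 1 - t| ≤ t² e^{|t|}` and `∫_{‖x‖<1} ‖x‖² dν < ∞`
  (`IsLevyMeasure.exists_lintegral_exp_norm_smallJumps_le`);
* the function `e^{ζ‖x‖}` is submultiplicative, so its integral against a compound Poisson law is
  at most the exponential of its integral against the jump measure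
  (`lintegral_compoundPoisson_le`), which gives one implication;
* a compound Poisson law dominates a multiple of its jump measure (`smul_le_compoundPoisson`), while
  the small jumps only cost the factor `∫ e^{-ζ‖x‖}`, which is bounded below uniformly in `n`; this
  gives the other implication, after truncating `e^{ζ‖x‖}` to a bounded function.
-/

namespace LampertiStable

open MeasureTheory Filter Topology
open scoped ENNReal NNReal

/-! ### Compound Poisson distributions -/

section CompoundPoisson

variable {E : Type*} [NormedAddCommGroup E] [MeasurableSpace E] [BorelSpace E]
  [SecondCountableTopology E]

instance isFiniteMeasure_convPow (ν : Measure E) [IsFiniteMeasure ν] (n : ℕ) :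
    IsFiniteMeasure (convPow ν n) := by
  induction n with
  | zero => unfold convPow; infer_instance
  | succ n ih => unfold convPow; infer_instance

theorem lintegral_convPow_le (ν : Measure E) [IsFiniteMeasure ν] {g : E → ℝ≥0∞}
    (hg : Measurable g) (h0 : g 0 ≤ 1) (hmul : ∀ x y, g (x + y) ≤ g x * g y) (n : ℕ) :
    ∫⁻ x, g x ∂(convPow ν n) ≤ (∫⁻ x, g x ∂ν) ^ n := by
  induction n with
  | zero => simpa [convPow, lintegral_dirac' _ hg] using h0
  | succ n ih =>
    rw [convPow, Measure.lintegral_conv hg, pow_succ]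
    calc _ ≤ ∫⁻ x, ∫⁻ y, g x * g y ∂ν ∂(convPow ν n) := by gcongr; exact hmul _ _
      _ = ∫⁻ x, g x * ∫⁻ y, g y ∂ν ∂(convPow ν n) := by
        simp_rw [lintegral_const_mul _ hg]
      _ = (∫⁻ x, g x ∂(convPow ν n)) * ∫⁻ y, g y ∂ν := lintegral_mul_const _ hg
      _ ≤ _ := by gcongr

/-- The compound Poisson distribution `e^{-ν(E)} ∑ₙ ν^{*n} / n!` with finite Lévy measure `ν`. -/
noncomputable def compoundPoisson (ν : Measure E) : Measure E :=
  Measure.sum fun n : ℕ =>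
    ENNReal.ofReal (Real.exp (-ν.real Set.univ) / n.factorial) • convPow ν n

/-- Submultiplicativity of `g` bounds each convolution power, and the series sums to an
exponential. -/
theorem lintegral_compoundPoisson_le (ν : Measure E) [IsFiniteMeasure ν] {g : E → ℝ≥0∞}
    (hg : Measurable g) (h0 : g 0 ≤ 1) (hmul : ∀ x y, g (x + y) ≤ g x * g y)
    (hfin : ∫⁻ x, g x ∂ν ≠ ⊤) :
    ∫⁻ x, g x ∂(compoundPoisson ν) ≤
      ENNReal.ofReal (Real.exp ((∫⁻ x, g x ∂ν).toReal - ν.real Set.univ)) := by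
  set a := (∫⁻ x, g x ∂ν).toReal with ha
  have ha' : ∫⁻ x, g x ∂ν = ENNReal.ofReal a := (ENNReal.ofReal_toReal hfin).symm
  have ha0 : 0 ≤ a := ENNReal.toReal_nonneg
  have hsum : HasSum (fun n : ℕ => Real.exp (-ν.real Set.univ) * (a ^ n / n.factorial))
      (Real.exp (-ν.real Set.univ) * Real.exp a) := by
    refine HasSum.mul_left _ ?_
    rw [Real.exp_eq_exp_ℝ]
    exact NormedSpace.expSeries_div_hasSum_exp a
  rw [compoundPoisson, lintegral_sum_measure, sub_eq_neg_add, Real.exp_add, ← hsum.tsum_eq,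
    ENNReal.ofReal_tsum_of_nonneg (fun n => by positivity) hsum.summable]
  refine ENNReal.tsum_le_tsum fun n => ?_
  rw [lintegral_smul_measure, smul_eq_mul]
  refine (mul_le_mul_right (lintegral_convPow_le ν hg h0 hmul n) _).trans_eq ?_
  rw [ha', ← ENNReal.ofReal_pow ha0, ← ENNReal.ofReal_mul (by positivity)]
  ring_nf

theorem isFiniteMeasure_compoundPoisson (ν : Measure E) [IsFiniteMeasure ν] :
    IsFiniteMeasure (compoundPoisson ν) := by
  refine ⟨?_⟩
  have h := lintegral_compoundPoisson_le ν (g := fun _ => 1) measurable_const le_rfl (by simp)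
    (by simp)
  simp only [lintegral_one] at h
  exact h.trans_lt ENNReal.ofReal_lt_top

/-- The term `n = 1` of the series: a single jump happens with positive probability. -/
theorem smul_le_compoundPoisson (ν : Measure E) [IsFiniteMeasure ν] :
    ENNReal.ofReal (Real.exp (-ν.real Set.univ)) • ν ≤ compoundPoisson ν := by
  have h := Measure.le_sum (fun n : ℕ =>
    ENNReal.ofReal (Real.exp (-ν.real Set.univ) / n.factorial) • convPow ν n) 1
  simpa [compoundPoisson, convPow, Measure.dirac_zero_conv] using h

theorem lintegral_exp_norm_compoundPoisson_lt_top (ν : Measure E) [IsFiniteMeasure ν] {ζ : ℝ}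
    (hζ : 0 ≤ ζ) (h : ∫⁻ x, ENNReal.ofReal (Real.exp (ζ * ‖x‖)) ∂ν < ⊤) :
    ∫⁻ x, ENNReal.ofReal (Real.exp (ζ * ‖x‖)) ∂(compoundPoisson ν) < ⊤ := by
  refine (lintegral_compoundPoisson_le ν (by fun_prop) (by simp) (fun x y => ?_) h.ne).trans_lt
    ENNReal.ofReal_lt_top
  rw [← ENNReal.ofReal_mul (by positivity), ← Real.exp_add, ← mul_add]
  gcongr
  exact norm_add_le x y

variable [InnerProductSpace ℝ E]

theorem charFun_convPow (ν : Measure E) [IsFiniteMeasure ν] (n : ℕ) (y : E) :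
    charFun (convPow ν n) y = charFun ν y ^ n := by
  induction n with
  | zero => simp [convPow, charFun_dirac]
  | succ n ih => rw [convPow, charFun_conv, ih, pow_succ]

theorem charFun_compoundPoisson (ν : Measure E) [IsFiniteMeasure ν] (y : E) :
    charFun (compoundPoisson ν) y = Complex.exp (charFun ν y - ν.real Set.univ) := by
  have hfin := isFiniteMeasure_compoundPoisson ν
  have hint : Integrable (fun x : E => Complex.exp (inner ℝ x y * Complex.I))
      (compoundPoisson ν) := by
    refine Integrable.of_bound (C := 1) (by fun_prop) (.of_forall fun x => ?_)
    rw [Complex.norm_exp_ofReal_mul_I]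
  have h1 := hasSum_integral_measure hint
  have h2 : HasSum (fun n : ℕ => Complex.exp (-ν.real Set.univ) *
      (charFun ν y ^ n / n.factorial))
      (Complex.exp (-ν.real Set.univ) * Complex.exp (charFun ν y)) := by
    refine HasSum.mul_left _ ?_
    rw [Complex.exp_eq_exp_ℂ]
    exact NormedSpace.expSeries_div_hasSum_exp (charFun ν y)
  rw [sub_eq_neg_add, Complex.exp_add]
  have hterm : ∀ n : ℕ, ∫ x, Complex.exp (inner ℝ x y * Complex.I)
      ∂(ENNReal.ofReal (Real.exp (-ν.real Set.univ) / n.factorial) • convPow ν n) =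
      Complex.exp (-ν.real Set.univ) * (charFun ν y ^ n / n.factorial) := fun n => by
    rw [integral_smul_measure, ← charFun_apply, charFun_convPow,
      ENNReal.toReal_ofReal (by positivity), Complex.real_smul]
    push_cast
    ring
  simp only [hterm] at h1
  exact h1.unique h2

instance isProbabilityMeasure_compoundPoisson (ν : Measure E) [IsFiniteMeasure ν] :
    IsProbabilityMeasure (compoundPoisson ν) := by
  have hfin := isFiniteMeasure_compoundPoisson ν
  have h := charFun_compoundPoisson ν 0
  rw [charFun_zero, charFun_zero, sub_self, Complex.exp_zero] at h
  have h' : (compoundPoisson ν).real Set.univ = 1 := by exact_mod_cast h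
  refine ⟨?_⟩
  rwa [measureReal_def, ENNReal.toReal_eq_one_iff] at h'

end CompoundPoisson

/-! ### Integrability against a Lévy measure -/

section LevyTriplet

variable {d : ℕ} {ν : Measure (EuclideanSpace ℝ (Fin d))}

theorem IsLevyMeasure.integrable_min_one_norm_sq (hν : IsLevyMeasure ν) :
    Integrable (fun x => min 1 (‖x‖ ^ 2)) ν :=
  ⟨by fun_prop, (hasFiniteIntegral_iff_ofReal (.of_forall fun x => by positivity)).2
    hν.lintegral_lt_top⟩

theorem IsLevyMeasure.measure_norm_ge_lt_top (hν : IsLevyMeasure ν) {ε : ℝ} (hε : 0 < ε) :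
    ν {x | ε ≤ ‖x‖} < ⊤ := by
  refine lt_of_le_of_lt (measure_mono fun x hx => ?_)
    (hν.integrable_min_one_norm_sq.measure_ge_lt_top (ε := min 1 (ε ^ 2)) (by positivity))
  have hx : ε ≤ ‖x‖ := hx
  exact min_le_min_left _ (pow_le_pow_left₀ hε.le hx 2)

theorem IsLevyMeasure.integrableOn_norm_sq (hν : IsLevyMeasure ν) :
    IntegrableOn (fun x => ‖x‖ ^ 2) (Metric.ball 0 1) ν := by
  refine (hν.integrable_min_one_norm_sq.integrableOn).congr_fun (fun x hx => ?_)
    measurableSet_ball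
  have hx : ‖x‖ < 1 := by simpa using hx
  exact min_eq_right (pow_le_one₀ (norm_nonneg x) hx.le)

/-! ### Exponential moments of the compensated small jumps -/

/-- The part `1/(n+1) ≤ ‖x‖ < 1` of the open unit ball. Shifting `n` by one keeps the inner radius
positive for every `n`, and the union over `n` omits only the origin. -/
def annulus (d n : ℕ) : Set (EuclideanSpace ℝ (Fin d)) :=
  {x | 1 / ((n : ℝ) + 1) ≤ ‖x‖} ∩ Metric.ball 0 1

theorem measurableSet_annulus (d n : ℕ) : MeasurableSet (annulus d n) :=
  (measurableSet_le measurable_const measurable_norm).inter measurableSet_ball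

theorem monotone_annulus (d : ℕ) : Monotone (annulus d) := fun m _ hmn x hx =>
  have hm : 1 / ((m : ℝ) + 1) ≤ ‖x‖ := hx.1
  ⟨(Nat.one_div_le_one_div hmn).trans hm, hx.2⟩

theorem iUnion_annulus (d : ℕ) : ⋃ n, annulus d n = Metric.ball 0 1 \ {0} := by
  ext x
  simp only [annulus, Set.mem_iUnion, Set.mem_inter_iff, Set.mem_sdiff, Set.mem_ofPred_eq,
    Set.mem_singleton_iff]
  refine ⟨fun ⟨n, hn, hx⟩ => ⟨hx, fun h0 => ?_⟩, fun ⟨hx, h0⟩ => ?_⟩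
  · rw [h0, norm_zero] at hn
    exact absurd hn (not_le.2 Nat.one_div_pos_of_nat)
  · obtain ⟨n, hn⟩ := exists_nat_one_div_lt (norm_pos_iff.2 h0)
    exact ⟨n, hn.le, hx⟩

theorem IsLevyMeasure.isFiniteMeasure_restrict_annulus (hν : IsLevyMeasure ν) (n : ℕ) :
    IsFiniteMeasure (ν.restrict (annulus d n)) :=
  isFiniteMeasure_restrict.2 ((measure_mono Set.inter_subset_left).trans_lt
    (hν.measure_norm_ge_lt_top Nat.one_div_pos_of_nat)).ne

theorem IsLevyMeasure.isFiniteMeasure_restrict_compl_ball (hν : IsLevyMeasure ν) :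
    IsFiniteMeasure (ν.restrict (Metric.ball 0 1)ᶜ) := by
  refine isFiniteMeasure_restrict.2 ((measure_mono fun x hx => ?_).trans_lt
    (hν.measure_norm_ge_lt_top one_pos)).ne
  simpa using hx

/-- The compound Poisson law of the jumps of size in `[1/(n+1), 1)`, shifted to have mean `b`. -/
noncomputable def smallJumps (b : EuclideanSpace ℝ (Fin d))
    (ν : Measure (EuclideanSpace ℝ (Fin d))) (n : ℕ) : Measure (EuclideanSpace ℝ (Fin d)) :=
  (Measure.dirac (b - ∫ x in annulus d n, x ∂ν)).conv
    (compoundPoisson (ν.restrict (annulus d n)))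

theorem norm_exp_sub_one_sub_le (z : ℂ) :
    ‖Complex.exp z - 1 - z‖ ≤ ‖z‖ ^ 2 * Real.exp ‖z‖ := by
  have h := Complex.norm_exp_sub_sum_le_norm_mul_exp z 2
  rw [Finset.sum_range_succ, Finset.sum_range_one] at h
  simpa [sub_sub] using h

/-- The quadratic bound makes exponential moments of `smallJumps b ν n` bounded in `n`. -/
theorem IsLevyMeasure.lintegral_exp_inner_smallJumps_le (hν : IsLevyMeasure ν)
    (b z : EuclideanSpace ℝ (Fin d)) (n : ℕ) :
    ∫⁻ x, ENNReal.ofReal (Real.exp (inner ℝ z x)) ∂(smallJumps b ν n) ≤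
      ENNReal.ofReal (Real.exp (inner ℝ z b +
        ‖z‖ ^ 2 * Real.exp ‖z‖ * ∫ x in Metric.ball 0 1, ‖x‖ ^ 2 ∂ν)) := by
  have hfin := hν.isFiniteMeasure_restrict_annulus n
  set ρ := ν.restrict (annulus d n) with hρ
  have hmem : ∀ᵐ x ∂ρ, ‖x‖ < 1 := by
    filter_upwards [ae_restrict_mem (measurableSet_annulus d n)] with x hx
    simpa using hx.2
  have hid : Integrable (fun x : EuclideanSpace ℝ (Fin d) => x) ρ :=
    Integrable.of_bound (C := 1) (by fun_prop) (hmem.mono fun x hx => hx.le)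
  have hin : Integrable (fun x => inner ℝ z x) ρ := hid.const_inner z
  have hexp : Integrable (fun x => Real.exp (inner ℝ z x)) ρ := by
    refine Integrable.of_bound (C := Real.exp ‖z‖) (by fun_prop) (hmem.mono fun x hx => ?_)
    rw [Real.norm_of_nonneg (Real.exp_pos _).le]
    refine Real.exp_le_exp.2 ((real_inner_le_norm z x).trans ?_)
    exact mul_le_of_le_one_right (norm_nonneg z) hx.le
  have hsq : Integrable (fun x => ‖x‖ ^ 2) ρ :=
    (hν.integrableOn_norm_sq).mono_set Set.inter_subset_right
  have hofReal : ∫⁻ x, ENNReal.ofReal (Real.exp (inner ℝ z x)) ∂ρ =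
      ENNReal.ofReal (∫ x, Real.exp (inner ℝ z x) ∂ρ) :=
    (ofReal_integral_eq_lintegral_ofReal hexp (.of_forall fun x => (Real.exp_pos _).le)).symm
  have hCP := lintegral_compoundPoisson_le ρ
    (g := fun x => ENNReal.ofReal (Real.exp (inner ℝ z x))) (by fun_prop) (by simp)
    (fun x y => by
      rw [← ENNReal.ofReal_mul (by positivity), ← Real.exp_add, inner_add_right])
    (by rw [hofReal]; exact ENNReal.ofReal_ne_top)
  rw [hofReal, ENNReal.toReal_ofReal (integral_nonneg fun x => (Real.exp_pos _).le)] at hCP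
  have hdiff : ∫ x, Real.exp (inner ℝ z x) ∂ρ - ρ.real Set.univ - inner ℝ z (∫ x, x ∂ρ) =
      ∫ x, (Real.exp (inner ℝ z x) - 1 - inner ℝ z x) ∂ρ := by
    have hexp1 : Integrable (fun x => Real.exp (inner ℝ z x) - 1) ρ :=
      hexp.sub (integrable_const 1)
    rw [integral_sub hexp1 hin, integral_sub hexp (integrable_const 1), integral_inner hid]
    simp
  have hbound : ∫ x, (Real.exp (inner ℝ z x) - 1 - inner ℝ z x) ∂ρ ≤
      ‖z‖ ^ 2 * Real.exp ‖z‖ * ∫ x in Metric.ball 0 1, ‖x‖ ^ 2 ∂ν := by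
    calc _ ≤ ∫ x, ‖z‖ ^ 2 * Real.exp ‖z‖ * ‖x‖ ^ 2 ∂ρ := by
          refine integral_mono_ae ((hexp.sub (integrable_const 1)).sub hin) (hsq.const_mul _)
            (hmem.mono fun x hx => ?_)
          have h1 : ‖Real.exp (inner ℝ z x) - 1 - inner ℝ z x‖ ≤
              |inner ℝ z x| ^ 2 * Real.exp |inner ℝ z x| := by
            have h := norm_exp_sub_one_sub_le ((inner ℝ z x : ℝ) : ℂ)
            rw [Complex.norm_real] at h
            exact_mod_cast h
          have h2 : |inner ℝ z x| ≤ ‖z‖ * ‖x‖ := abs_real_inner_le_norm z x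
          have h3 : ‖z‖ * ‖x‖ ≤ ‖z‖ := mul_le_of_le_one_right (norm_nonneg z) hx.le
          calc _ ≤ |inner ℝ z x| ^ 2 * Real.exp |inner ℝ z x| := (le_abs_self _).trans h1
            _ ≤ (‖z‖ * ‖x‖) ^ 2 * Real.exp ‖z‖ := by
              gcongr
              exact h2.trans h3
            _ = ‖z‖ ^ 2 * Real.exp ‖z‖ * ‖x‖ ^ 2 := by ring
      _ = ‖z‖ ^ 2 * Real.exp ‖z‖ * ∫ x, ‖x‖ ^ 2 ∂ρ := integral_const_mul _ _
      _ ≤ _ := by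
        gcongr ?_ * ?_
        exact setIntegral_mono_set hν.integrableOn_norm_sq
          (.of_forall fun x => by positivity) Set.inter_subset_right.eventuallyLE
  rw [smallJumps, Measure.lintegral_conv (by fun_prop), lintegral_dirac' _ (by
    refine Measurable.lintegral_prod_right' (f := fun p : _ × _ =>
      ENNReal.ofReal (Real.exp (inner ℝ z (p.1 + p.2)))) (by fun_prop))]
  simp_rw [inner_add_right, Real.exp_add, ENNReal.ofReal_mul (Real.exp_pos _).le]
  rw [lintegral_const_mul _ (by fun_prop), ← ENNReal.ofReal_mul (Real.exp_pos _).le,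
    ← Real.exp_add]
  refine (mul_le_mul_right hCP _).trans ?_
  rw [← ENNReal.ofReal_mul (Real.exp_pos _).le, ← Real.exp_add]
  refine ENNReal.ofReal_le_ofReal (Real.exp_le_exp.2 ?_)
  rw [inner_sub_right]
  linarith

/-- `e^{η‖x‖}` is dominated by a finite sum of exponentials of linear functionals, since `‖x‖` is
at most `d` times the largest coordinate in absolute value. -/
theorem exp_norm_le_sum (η : ℝ) (hη : 0 ≤ η) (x : EuclideanSpace ℝ (Fin d)) :
    Real.exp (η * ‖x‖) ≤ 1 + ∑ i, (Real.exp (inner ℝ (EuclideanSpace.single i (η * d)) x) +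
      Real.exp (inner ℝ (EuclideanSpace.single i (-(η * d))) x)) := by
  have hnonneg : ∀ i : Fin d, 0 ≤ Real.exp (inner ℝ (EuclideanSpace.single i (η * d)) x) +
      Real.exp (inner ℝ (EuclideanSpace.single i (-(η * d))) x) := fun i => by positivity
  rcases isEmpty_or_nonempty (Fin d) with hd | hd
  · have hx : x = 0 := Subsingleton.elim _ _
    simp [hx]
  obtain ⟨i, -, hi⟩ := Finset.exists_max_image Finset.univ (fun i => |x i|) Finset.univ_nonempty
  have hnorm : ‖x‖ ≤ d * |x i| := by
    have hsq : ∑ j, ‖x j‖ ^ 2 ≤ (∑ j, ‖x j‖) ^ 2 :=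
      Finset.sum_sq_le_sq_sum_of_nonneg fun j _ => norm_nonneg _
    have hs : ∑ j, ‖x j‖ ≤ d * |x i| := by
      simpa using Finset.sum_le_card_nsmul Finset.univ (fun j => ‖x j‖) (|x i|) hi
    rw [EuclideanSpace.norm_eq]
    exact (Real.sqrt_le_left (by positivity)).2 (hsq.trans (by gcongr))
  have habs : Real.exp (η * ‖x‖) ≤ Real.exp (η * d * |x i|) := by
    rw [mul_assoc]
    gcongr
  have hexp : Real.exp (η * d * |x i|) ≤
      Real.exp (inner ℝ (EuclideanSpace.single i (η * d)) x) +
      Real.exp (inner ℝ (EuclideanSpace.single i (-(η * d))) x) := by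
    simp only [EuclideanSpace.inner_single_left, conj_trivial]
    rcases abs_cases (x i) with h | h <;> rw [h.1]
    · linarith [Real.exp_pos (-(η * d) * x i)]
    · rw [mul_neg, ← neg_mul]
      linarith [Real.exp_pos (η * d * x i)]
  have := Finset.single_le_sum (fun i _ => hnonneg i) (Finset.mem_univ i)
  linarith

theorem IsLevyMeasure.isProbabilityMeasure_smallJumps (hν : IsLevyMeasure ν)
    (b : EuclideanSpace ℝ (Fin d)) (n : ℕ) : IsProbabilityMeasure (smallJumps b ν n) := by
  have := hν.isFiniteMeasure_restrict_annulus n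
  unfold smallJumps
  infer_instance

theorem IsLevyMeasure.exists_lintegral_exp_norm_smallJumps_le (hν : IsLevyMeasure ν)
    (b : EuclideanSpace ℝ (Fin d)) {η : ℝ} (hη : 0 ≤ η) :
    ∃ C : ℝ≥0∞, C < ⊤ ∧
      ∀ n, ∫⁻ x, ENNReal.ofReal (Real.exp (η * ‖x‖)) ∂(smallJumps b ν n) ≤ C := by
  set B : EuclideanSpace ℝ (Fin d) → ℝ≥0∞ := fun z => ENNReal.ofReal (Real.exp (inner ℝ z b +
    ‖z‖ ^ 2 * Real.exp ‖z‖ * ∫ x in Metric.ball 0 1, ‖x‖ ^ 2 ∂ν)) with hB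
  refine ⟨1 + ∑ i, (B (EuclideanSpace.single i (η * d)) +
    B (EuclideanSpace.single i (-(η * d)))), ?_, fun n => ?_⟩
  · simp [hB, ENNReal.add_lt_top, ENNReal.sum_lt_top]
  · have := hν.isProbabilityMeasure_smallJumps b n
    calc _ ≤ ∫⁻ x, (1 + ∑ i,
          (ENNReal.ofReal (Real.exp (inner ℝ (EuclideanSpace.single i (η * d)) x)) +
            ENNReal.ofReal (Real.exp (inner ℝ (EuclideanSpace.single i (-(η * d))) x))))
          ∂(smallJumps b ν n) := by
          refine lintegral_mono fun x => ?_
          refine (ENNReal.ofReal_le_ofReal (exp_norm_le_sum η hη x)).trans_eq ?_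
          rw [ENNReal.ofReal_add zero_le_one (Finset.sum_nonneg fun i _ => by positivity),
            ENNReal.ofReal_one, ENNReal.ofReal_sum_of_nonneg fun i _ => by positivity]
          congr 1
          exact Finset.sum_congr rfl fun i _ =>
            ENNReal.ofReal_add (Real.exp_pos _).le (Real.exp_pos _).le
      _ = 1 + ∑ i,
          (∫⁻ x, ENNReal.ofReal (Real.exp (inner ℝ (EuclideanSpace.single i (η * d)) x))
              ∂(smallJumps b ν n) +
            ∫⁻ x, ENNReal.ofReal (Real.exp (inner ℝ (EuclideanSpace.single i (-(η * d))) x))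
              ∂(smallJumps b ν n)) := by
          rw [lintegral_add_left measurable_const, lintegral_finsetSum _ (by fun_prop)]
          simp only [lintegral_const, measure_univ, mul_one]
          congr 1
          exact Finset.sum_congr rfl fun i _ => lintegral_add_left (by fun_prop) _
      _ ≤ _ := by
        gcongr <;> exact hν.lintegral_exp_inner_smallJumps_le b _ n

/-! ### Weak convergence of the truncated laws -/

/-- The integrand `e^{i⟨y,x⟩} - 1 - i⟨y,x⟩ 1_{‖x‖<1}` of the Lévy–Khintchine exponent. -/
noncomputable def levyIntegrand (y x : EuclideanSpace ℝ (Fin d)) : ℂ :=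
  Complex.exp (Complex.I * (inner ℝ y x : ℝ)) - 1 - Complex.I * (inner ℝ y x : ℝ) *
    (Metric.ball (0 : EuclideanSpace ℝ (Fin d)) 1).indicator (fun _ => (1 : ℂ)) x

theorem measurable_levyIntegrand (y : EuclideanSpace ℝ (Fin d)) :
    Measurable (levyIntegrand y) := by
  have h : Measurable ((Metric.ball (0 : EuclideanSpace ℝ (Fin d)) 1).indicator
      (fun _ => (1 : ℂ))) := measurable_const.indicator measurableSet_ball
  unfold levyIntegrand
  fun_prop

theorem norm_levyIntegrand_le (y x : EuclideanSpace ℝ (Fin d)) :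
    ‖levyIntegrand y x‖ ≤ (‖y‖ ^ 2 * Real.exp ‖y‖ + 2) * min 1 (‖x‖ ^ 2) := by
  by_cases hx : x ∈ Metric.ball (0 : EuclideanSpace ℝ (Fin d)) 1
  · have hx1 : ‖x‖ < 1 := by simpa using hx
    have hz : ‖Complex.I * (inner ℝ y x : ℝ)‖ ≤ ‖y‖ * ‖x‖ := by
      rw [norm_mul, Complex.norm_I, one_mul, Complex.norm_real]
      exact norm_inner_le_norm y x
    have hy : ‖y‖ * ‖x‖ ≤ ‖y‖ := mul_le_of_le_one_right (norm_nonneg y) hx1.le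
    rw [levyIntegrand, Set.indicator_of_mem hx, mul_one,
      min_eq_right (pow_le_one₀ (norm_nonneg x) hx1.le)]
    calc _ ≤ (‖y‖ * ‖x‖) ^ 2 * Real.exp ‖y‖ := by
          refine (norm_exp_sub_one_sub_le _).trans ?_
          gcongr
          exact hz.trans hy
      _ = ‖y‖ ^ 2 * Real.exp ‖y‖ * ‖x‖ ^ 2 := by ring
      _ ≤ _ := by gcongr; linarith
  · have hx1 : 1 ≤ ‖x‖ := by simpa using hx
    rw [levyIntegrand, Set.indicator_of_notMem hx, mul_zero, sub_zero,
      min_eq_left (one_le_pow₀ hx1), mul_one]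
    have h1 : ‖Complex.exp (Complex.I * (inner ℝ y x : ℝ))‖ = 1 := by
      rw [mul_comm, Complex.norm_exp_ofReal_mul_I]
    have h2 := norm_sub_le (Complex.exp (Complex.I * (inner ℝ y x : ℝ))) 1
    rw [h1, norm_one] at h2
    have h3 : 0 ≤ ‖y‖ ^ 2 * Real.exp ‖y‖ := by positivity
    linarith

theorem IsLevyMeasure.integrable_levyIntegrand (hν : IsLevyMeasure ν)
    (y : EuclideanSpace ℝ (Fin d)) : Integrable (levyIntegrand y) ν :=
  (hν.integrable_min_one_norm_sq.const_mul _).mono'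
    (measurable_levyIntegrand y).aestronglyMeasurable (.of_forall (norm_levyIntegrand_le y))

/-- The infinitely divisible law with drift `b` whose Lévy measure is the restriction of `ν` to
`‖x‖ ≥ 1/(n+1)`, built as small jumps convolved with large jumps. -/
noncomputable def truncatedLaw (b : EuclideanSpace ℝ (Fin d))
    (ν : Measure (EuclideanSpace ℝ (Fin d))) (n : ℕ) : Measure (EuclideanSpace ℝ (Fin d)) :=
  (smallJumps b ν n).conv (compoundPoisson (ν.restrict (Metric.ball 0 1)ᶜ))

theorem IsLevyMeasure.isProbabilityMeasure_truncatedLaw (hν : IsLevyMeasure ν)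
    (b : EuclideanSpace ℝ (Fin d)) (n : ℕ) : IsProbabilityMeasure (truncatedLaw b ν n) := by
  have := hν.isProbabilityMeasure_smallJumps b n
  have := hν.isFiniteMeasure_restrict_compl_ball
  unfold truncatedLaw
  infer_instance

theorem charFun_sub_real_univ {ρ : Measure (EuclideanSpace ℝ (Fin d))} [IsFiniteMeasure ρ]
    (y : EuclideanSpace ℝ (Fin d)) : charFun ρ y - ρ.real Set.univ =
      ∫ x, (Complex.exp (Complex.I * (inner ℝ y x : ℝ)) - 1) ∂ρ := by
  rw [integral_sub _ (integrable_const 1), charFun_apply]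
  · simp [real_inner_comm, mul_comm]
  · refine Integrable.of_bound (C := 1) (by fun_prop) (.of_forall fun x => ?_)
    rw [mul_comm, Complex.norm_exp_ofReal_mul_I]

theorem IsLevyMeasure.charFun_truncatedLaw (hν : IsLevyMeasure ν)
    (b y : EuclideanSpace ℝ (Fin d)) (n : ℕ) :
    charFun (truncatedLaw b ν n) y = Complex.exp (Complex.I * (inner ℝ y b : ℝ) +
      ∫ x in annulus d n, levyIntegrand y x ∂ν +
      ∫ x in (Metric.ball 0 1)ᶜ, levyIntegrand y x ∂ν) := by
  have hfin := hν.isFiniteMeasure_restrict_annulus n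
  have hfin' := hν.isFiniteMeasure_restrict_compl_ball
  have hprob := hν.isProbabilityMeasure_smallJumps b n
  have hmem : ∀ᵐ x ∂(ν.restrict (annulus d n)), ‖x‖ < 1 := by
    filter_upwards [ae_restrict_mem (measurableSet_annulus d n)] with x hx
    simpa using hx.2
  have hid : Integrable (fun x : EuclideanSpace ℝ (Fin d) => x) (ν.restrict (annulus d n)) :=
    Integrable.of_bound (C := 1) (by fun_prop) (hmem.mono fun x hx => hx.le)
  have hin : Integrable (fun x => Complex.I * ((inner ℝ y x : ℝ) : ℂ))
      (ν.restrict (annulus d n)) := ((hid.const_inner y).ofReal).const_mul _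
  have hexp : Integrable (fun x => Complex.exp (Complex.I * (inner ℝ y x : ℝ)) - 1)
      (ν.restrict (annulus d n)) := by
    refine Integrable.of_bound (C := 1 + 1) (by fun_prop) (.of_forall fun x => ?_)
    refine (norm_sub_le _ _).trans ?_
    rw [mul_comm, Complex.norm_exp_ofReal_mul_I, norm_one]
  have hsmall : ∫ x in annulus d n, levyIntegrand y x ∂ν =
      ∫ x in annulus d n, (Complex.exp (Complex.I * (inner ℝ y x : ℝ)) - 1) ∂ν -
        Complex.I * (inner ℝ y (∫ x in annulus d n, x ∂ν) : ℝ) := by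
    rw [← integral_inner hid, ← integral_complex_ofReal, ← integral_const_mul,
      ← integral_sub hexp hin]
    refine setIntegral_congr_fun (measurableSet_annulus d n) fun x hx => ?_
    simp only [levyIntegrand, Set.indicator_of_mem hx.2, mul_one]
  have hbig : ∫ x in (Metric.ball 0 1)ᶜ, levyIntegrand y x ∂ν =
      ∫ x in (Metric.ball 0 1)ᶜ, (Complex.exp (Complex.I * (inner ℝ y x : ℝ)) - 1) ∂ν := by
    refine setIntegral_congr_fun measurableSet_ball.compl fun x hx => ?_
    simp only [levyIntegrand, Set.indicator_of_notMem hx, mul_zero, sub_zero]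
  rw [truncatedLaw, charFun_conv, smallJumps, charFun_conv, charFun_dirac,
    charFun_compoundPoisson, charFun_compoundPoisson, charFun_sub_real_univ,
    charFun_sub_real_univ, hsmall, hbig, ← Complex.exp_add, ← Complex.exp_add,
    real_inner_comm, inner_sub_right]
  congr 1
  push_cast
  ring

theorem HasLevyTriplet.tendsto_charFun_truncatedLaw {μ : Measure (EuclideanSpace ℝ (Fin d))}
    {b : EuclideanSpace ℝ (Fin d)} (h : HasLevyTriplet μ 0 ν b) (y : EuclideanSpace ℝ (Fin d)) :
    Tendsto (fun n => charFun (truncatedLaw b ν n) y) atTop (𝓝 (charFun μ y)) := by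
  have hν := h.isLevyMeasure
  have hint := hν.integrable_levyIntegrand y
  have hlim : Tendsto (fun n => ∫ x in annulus d n, levyIntegrand y x ∂ν) atTop
      (𝓝 (∫ x in Metric.ball 0 1, levyIntegrand y x ∂ν)) := by
    have h1 := tendsto_setIntegral_of_monotone (measurableSet_annulus d) (monotone_annulus d)
      hint.integrableOn
    rw [iUnion_annulus, setIntegral_congr_set (sdiff_null_ae_eq_self hν.zero_null)] at h1
    exact h1
  have hexponent : levyExponent b 0 ν y = Complex.I * (inner ℝ y b : ℝ) +
      ∫ x in Metric.ball 0 1, levyIntegrand y x ∂ν +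
      ∫ x in (Metric.ball 0 1)ᶜ, levyIntegrand y x ∂ν := by
    rw [add_assoc, integral_add_compl measurableSet_ball hint, levyExponent]
    simp [levyIntegrand]
  simp_rw [hν.charFun_truncatedLaw, h.charFun_eq, hexponent]
  exact (Complex.continuous_exp.tendsto _).comp ((hlim.const_add _).add_const _)

theorem HasLevyTriplet.tendsto_truncatedLaw {μ : ProbabilityMeasure (EuclideanSpace ℝ (Fin d))}
    {b : EuclideanSpace ℝ (Fin d)} (h : HasLevyTriplet μ 0 ν b) :
    Tendsto (β := ProbabilityMeasure (EuclideanSpace ℝ (Fin d)))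
      (fun n => ⟨truncatedLaw b ν n, h.isLevyMeasure.isProbabilityMeasure_truncatedLaw b n⟩)
      atTop (𝓝 μ) :=
  ProbabilityMeasure.tendsto_iff_tendsto_charFun.2 h.tendsto_charFun_truncatedLaw

theorem HasLevyTriplet.lintegral_le_of_truncatedLaw {μ : Measure (EuclideanSpace ℝ (Fin d))}
    {b : EuclideanSpace ℝ (Fin d)} (h : HasLevyTriplet μ 0 ν b)
    {g : EuclideanSpace ℝ (Fin d) → ℝ} (hg : Continuous g) (h0 : 0 ≤ g) {C : ℝ≥0∞}
    (hC : ∀ n, ∫⁻ x, ENNReal.ofReal (g x) ∂(truncatedLaw b ν n) ≤ C) :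
    ∫⁻ x, ENNReal.ofReal (g x) ∂μ ≤ C := by
  have hlim := HasLevyTriplet.tendsto_truncatedLaw (μ := ⟨μ, h.infinitelyDivisible.1⟩) h
  refine (lintegral_le_liminf_lintegral_of_forall_isOpen_measure_le_liminf_measure hg h0
    fun G hG => ProbabilityMeasure.le_liminf_measure_open_of_tendsto hlim hG).trans ?_
  exact liminf_le_of_le (by isBoundedDefault) fun c hc => by
    obtain ⟨n, hn⟩ := hc.exists
    exact hn.trans (hC n)

theorem HasLevyTriplet.tendsto_lintegral_truncatedLaw {μ : Measure (EuclideanSpace ℝ (Fin d))}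
    {b : EuclideanSpace ℝ (Fin d)} (h : HasLevyTriplet μ 0 ν b)
    {g : EuclideanSpace ℝ (Fin d) → ℝ} (hg : Continuous g) {N : ℝ}
    (hN : ∀ x, g x ∈ Set.Icc 0 N) :
    Tendsto (fun n => ∫⁻ x, ENNReal.ofReal (g x) ∂(truncatedLaw b ν n)) atTop
      (𝓝 (∫⁻ x, ENNReal.ofReal (g x) ∂μ)) := by
  have hlim := HasLevyTriplet.tendsto_truncatedLaw (μ := ⟨μ, h.infinitelyDivisible.1⟩) h
  exact (ProbabilityMeasure.tendsto_iff_forall_lintegral_tendsto.1 hlim)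
    (BoundedContinuousFunction.mkOfBound ⟨fun x => (g x).toNNReal, by fun_prop⟩ N fun x y => by
      simp only [ContinuousMap.coe_mk, NNReal.dist_eq, Real.coe_toNNReal _ (hN _).1]
      exact abs_sub_le_of_le_of_le (hN x).1 (hN x).2 (hN y).1 (hN y).2 |>.trans (by simp))

/-! ### Exponential moments of infinitely divisible laws -/

/-- Submultiplicativity of `e^{ζ‖x‖}` splits its integral against the truncated law into the small
jumps, bounded uniformly in `n`, and the large jumps. -/
theorem HasLevyTriplet.lintegral_exp_norm_lt_top {μ : Measure (EuclideanSpace ℝ (Fin d))}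
    {b : EuclideanSpace ℝ (Fin d)} (h : HasLevyTriplet μ 0 ν b) {ζ : ℝ} (hζ : 0 ≤ ζ)
    (hfin : ∫⁻ x in (Metric.ball 0 1)ᶜ, ENNReal.ofReal (Real.exp (ζ * ‖x‖)) ∂ν < ⊤) :
    ∫⁻ x, ENNReal.ofReal (Real.exp (ζ * ‖x‖)) ∂μ < ⊤ := by
  have hν := h.isLevyMeasure
  have hfinite := hν.isFiniteMeasure_restrict_compl_ball
  obtain ⟨C, hC, hCle⟩ := hν.exists_lintegral_exp_norm_smallJumps_le b hζ
  refine (h.lintegral_le_of_truncatedLaw (by fun_prop) (fun x => (Real.exp_pos _).le)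
    fun n => ?_).trans_lt
    (ENNReal.mul_lt_top hC (lintegral_exp_norm_compoundPoisson_lt_top _ hζ hfin))
  rw [truncatedLaw, Measure.lintegral_conv (by fun_prop)]
  calc _ ≤ ∫⁻ x, ∫⁻ y, ENNReal.ofReal (Real.exp (ζ * ‖x‖)) *
        ENNReal.ofReal (Real.exp (ζ * ‖y‖))
          ∂(compoundPoisson (ν.restrict (Metric.ball 0 1)ᶜ)) ∂(smallJumps b ν n) := by
        refine lintegral_mono fun x => lintegral_mono fun y => ?_
        rw [← ENNReal.ofReal_mul (by positivity), ← Real.exp_add, ← mul_add]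
        gcongr
        exact norm_add_le x y
    _ = (∫⁻ x, ENNReal.ofReal (Real.exp (ζ * ‖x‖)) ∂(smallJumps b ν n)) *
        ∫⁻ y, ENNReal.ofReal (Real.exp (ζ * ‖y‖))
          ∂(compoundPoisson (ν.restrict (Metric.ball 0 1)ᶜ)) := by
        simp_rw [lintegral_const_mul _ (show Measurable fun y : EuclideanSpace ℝ (Fin d) =>
          ENNReal.ofReal (Real.exp (ζ * ‖y‖)) by fun_prop)]
        exact lintegral_mul_const _ (by fun_prop)
    _ ≤ _ := by gcongr; exact hCle n

/-- A quantitative form of tightness: `∫ e^{-η‖x‖} ≥ 1 / ∫ e^{η‖x‖}` for a probability measure, and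
the exponential moments of the small jumps are bounded in `n`. -/
theorem IsLevyMeasure.exists_le_lintegral_exp_neg_norm_smallJumps (hν : IsLevyMeasure ν)
    (b : EuclideanSpace ℝ (Fin d)) {η : ℝ} (hη : 0 ≤ η) :
    ∃ a : ℝ, 0 < a ∧
      ∀ n, ENNReal.ofReal a ≤
        ∫⁻ x, ENNReal.ofReal (Real.exp (-(η * ‖x‖))) ∂(smallJumps b ν n) := by
  obtain ⟨C, hC, hCle⟩ := hν.exists_lintegral_exp_norm_smallJumps_le b hη
  set c : ℝ := C.toReal + 1 with hc
  have hc0 : 0 < c := by positivity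
  have hCc : C ≤ ENNReal.ofReal c := by
    rw [← ENNReal.ofReal_toReal hC.ne]
    exact ENNReal.ofReal_le_ofReal (by linarith)
  refine ⟨c⁻¹, by positivity, fun n => ?_⟩
  have hprob := hν.isProbabilityMeasure_smallJumps b n
  have key : ENNReal.ofReal c⁻¹ + ENNReal.ofReal c⁻¹ ≤
      ∫⁻ x, ENNReal.ofReal (Real.exp (-(η * ‖x‖))) ∂(smallJumps b ν n) +
        ENNReal.ofReal c⁻¹ := by
    calc _ = ∫⁻ x, ENNReal.ofReal (2 * c⁻¹) ∂(smallJumps b ν n) := by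
          rw [lintegral_const, measure_univ, mul_one,
            ← ENNReal.ofReal_add (by positivity) (by positivity), two_mul]
      _ ≤ ∫⁻ x, (ENNReal.ofReal (Real.exp (-(η * ‖x‖))) +
          ENNReal.ofReal ((c⁻¹) ^ 2) * ENNReal.ofReal (Real.exp (η * ‖x‖)))
            ∂(smallJumps b ν n) := by
          refine lintegral_mono fun x => ?_
          rw [← ENNReal.ofReal_mul (by positivity),
            ← ENNReal.ofReal_add (by positivity) (by positivity)]
          refine ENNReal.ofReal_le_ofReal ?_
          -- Expand `e^{-t} (1 - c⁻¹ e^t)² ≥ 0`.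
          have hmul : Real.exp (-(η * ‖x‖)) * Real.exp (η * ‖x‖) = 1 := by
            rw [← Real.exp_add, neg_add_cancel, Real.exp_zero]
          have hsq : 0 ≤ Real.exp (-(η * ‖x‖)) * (1 - c⁻¹ * Real.exp (η * ‖x‖)) ^ 2 := by
            positivity
          have hexpand : Real.exp (-(η * ‖x‖)) * (1 - c⁻¹ * Real.exp (η * ‖x‖)) ^ 2 =
              Real.exp (-(η * ‖x‖)) + c⁻¹ ^ 2 * Real.exp (η * ‖x‖) - 2 * c⁻¹ := by
            linear_combination
              (c⁻¹ ^ 2 * Real.exp (η * ‖x‖) - 2 * c⁻¹) * hmul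
          linarith
      _ = ∫⁻ x, ENNReal.ofReal (Real.exp (-(η * ‖x‖))) ∂(smallJumps b ν n) +
          ENNReal.ofReal ((c⁻¹) ^ 2) *
            ∫⁻ x, ENNReal.ofReal (Real.exp (η * ‖x‖)) ∂(smallJumps b ν n) := by
          rw [lintegral_add_left (by fun_prop), lintegral_const_mul _ (by fun_prop)]
      _ ≤ ∫⁻ x, ENNReal.ofReal (Real.exp (-(η * ‖x‖))) ∂(smallJumps b ν n) +
          ENNReal.ofReal ((c⁻¹) ^ 2) * ENNReal.ofReal c := by
          gcongr
          exact (hCle n).trans hCc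
      _ = _ := by
          rw [← ENNReal.ofReal_mul (by positivity)]
          congr 2
          field_simp
  exact ENNReal.le_of_add_le_add_right ENNReal.ofReal_ne_top key

/-- The bound is proved for `e^{ζ‖x‖}` cut off at height `N`, for which weak convergence applies, and
`N` is sent to infinity. The cut-off function `g` still satisfies `e^{-ζ‖x‖} g(y) ≤ g(x + y)`. -/
theorem HasLevyTriplet.lintegral_exp_norm_compl_ball_lt_top
    {μ : Measure (EuclideanSpace ℝ (Fin d))}
    {b : EuclideanSpace ℝ (Fin d)} (h : HasLevyTriplet μ 0 ν b) {ζ : ℝ} (hζ : 0 ≤ ζ)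
    (hfin : ∫⁻ x, ENNReal.ofReal (Real.exp (ζ * ‖x‖)) ∂μ < ⊤) :
    ∫⁻ x in (Metric.ball 0 1)ᶜ, ENNReal.ofReal (Real.exp (ζ * ‖x‖)) ∂ν < ⊤ := by
  have hν := h.isLevyMeasure
  have hfinite := hν.isFiniteMeasure_restrict_compl_ball
  set ρ := ν.restrict (Metric.ball 0 1)ᶜ with hρ
  obtain ⟨a, ha, hale⟩ := hν.exists_le_lintegral_exp_neg_norm_smallJumps b hζ
  set M := ∫⁻ x, ENNReal.ofReal (Real.exp (ζ * ‖x‖)) ∂μ with hM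
  set K : ℝ := a * Real.exp (-ρ.real Set.univ) with hK
  have hK0 : 0 < K := by positivity
  set g : ℕ → EuclideanSpace ℝ (Fin d) → ℝ := fun N x => min (N : ℝ) (Real.exp (ζ * ‖x‖)) with hg
  have hgm : ∀ N, Continuous (g N) := fun N => by simp only [hg]; fun_prop
  have hgmul : ∀ N x y, Real.exp (-(ζ * ‖x‖)) * g N y ≤ g N (x + y) := fun N x y => by
    have h1 : Real.exp (-(ζ * ‖x‖)) ≤ 1 := Real.exp_le_one_iff.2 (by
      have := mul_nonneg hζ (norm_nonneg x)
      linarith)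
    simp only [hg]
    rw [mul_min_of_nonneg _ _ (Real.exp_pos _).le]
    refine min_le_min (mul_le_of_le_one_left (Nat.cast_nonneg N) h1) ?_
    rw [← Real.exp_add]
    refine Real.exp_le_exp.2 ?_
    have h2 : ‖y‖ ≤ ‖x‖ + ‖x + y‖ := by
      have := norm_sub_le (x + y) x
      rw [add_sub_cancel_left] at this
      linarith
    have := mul_le_mul_of_nonneg_left h2 hζ
    linarith
  have hbound : ∀ N, ENNReal.ofReal K * ∫⁻ x, ENNReal.ofReal (g N x) ∂ρ ≤ M := fun N => by
    refine le_trans (ge_of_tendsto' (h.tendsto_lintegral_truncatedLaw (hgm N) (N := N)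
      fun x => ⟨le_min (Nat.cast_nonneg N) (Real.exp_pos _).le, min_le_left _ _⟩) fun n => ?_)
      (lintegral_mono fun x => ENNReal.ofReal_le_ofReal (min_le_right _ _))
    have hgN := (hgm N).measurable
    calc _ = ENNReal.ofReal a * ∫⁻ x, ENNReal.ofReal (g N x)
            ∂(ENNReal.ofReal (Real.exp (-ρ.real Set.univ)) • ρ) := by
          rw [lintegral_smul_measure, smul_eq_mul, hK, ENNReal.ofReal_mul ha.le, mul_assoc]
      _ ≤ (∫⁻ x, ENNReal.ofReal (Real.exp (-(ζ * ‖x‖))) ∂(smallJumps b ν n)) *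
          ∫⁻ y, ENNReal.ofReal (g N y) ∂(compoundPoisson ρ) := by
          gcongr
          · exact hale n
          · exact smul_le_compoundPoisson ρ
      _ = ∫⁻ x, ∫⁻ y, ENNReal.ofReal (Real.exp (-(ζ * ‖x‖))) * ENNReal.ofReal (g N y)
          ∂(compoundPoisson ρ) ∂(smallJumps b ν n) := by
          simp_rw [lintegral_const_mul _ hgN.ennreal_ofReal]
          exact (lintegral_mul_const _ (by fun_prop)).symm
      _ ≤ ∫⁻ x, ∫⁻ y, ENNReal.ofReal (g N (x + y))
          ∂(compoundPoisson ρ) ∂(smallJumps b ν n) := by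
          refine lintegral_mono fun x => lintegral_mono fun y => ?_
          rw [← ENNReal.ofReal_mul (Real.exp_pos _).le]
          exact ENNReal.ofReal_le_ofReal (hgmul N x y)
      _ = _ := by rw [truncatedLaw, Measure.lintegral_conv hgN.ennreal_ofReal]
  have hlim : Tendsto (fun N => ∫⁻ x, ENNReal.ofReal (g N x) ∂ρ) atTop
      (𝓝 (∫⁻ x, ENNReal.ofReal (Real.exp (ζ * ‖x‖)) ∂ρ)) := by
    refine lintegral_tendsto_of_tendsto_of_monotone
      (fun N => (hgm N).measurable.ennreal_ofReal.aemeasurable)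
      (.of_forall fun x N N' hN => ENNReal.ofReal_le_ofReal (min_le_min_right _ (by
        exact_mod_cast hN))) (.of_forall fun x => ?_)
    refine tendsto_const_nhds.congr' ?_
    filter_upwards [eventually_ge_atTop ⌈Real.exp (ζ * ‖x‖)⌉₊] with N hN
    simp only [hg]
    rw [min_eq_right (Nat.ceil_le.1 hN)]
  have hKfin : M / ENNReal.ofReal K < ⊤ :=
    ENNReal.div_lt_top hfin.ne (ENNReal.ofReal_pos.2 hK0).ne'
  refine (le_of_tendsto' hlim fun N => ?_).trans_lt hKfin
  rw [ENNReal.le_div_iff_mul_le (.inl (ENNReal.ofReal_pos.2 hK0).ne')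
    (.inl ENNReal.ofReal_ne_top), mul_comm]
  exact hbound N

/-- For an infinitely divisible law without Gaussian part, exponential moments of the norm are
finite exactly when they are finite for the large jumps. -/
theorem HasLevyTriplet.lintegral_exp_norm_lt_top_iff {μ : Measure (EuclideanSpace ℝ (Fin d))}
    {b : EuclideanSpace ℝ (Fin d)} (h : HasLevyTriplet μ 0 ν b) {ζ : ℝ} (hζ : 0 ≤ ζ) :
    ∫⁻ x, ENNReal.ofReal (Real.exp (ζ * ‖x‖)) ∂μ < ⊤ ↔
      ∫⁻ x in (Metric.ball 0 1)ᶜ, ENNReal.ofReal (Real.exp (ζ * ‖x‖)) ∂ν < ⊤ :=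
  ⟨h.lintegral_exp_norm_compl_ball_lt_top hζ, h.lintegral_exp_norm_lt_top hζ⟩

end LevyTriplet

/-! ### Lamperti stable laws -/

variable {d : ℕ} {α : ℝ} {f : Metric.sphere (0 : EuclideanSpace ℝ (Fin d)) 1 → ℝ}
  {σ : Measure (Metric.sphere (0 : EuclideanSpace ℝ (Fin d)) 1)}

theorem lintegral_exp_norm_compl_ball_levyMeasure (hf : Measurable f) (ζ : ℝ) :
    ∫⁻ x in (Metric.ball 0 1)ᶜ, ENNReal.ofReal (Real.exp (ζ * ‖x‖)) ∂(levyMeasure α f σ) =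
      ∫⁻ ξ, (∫⁻ r in Set.Ici (1 : ℝ), ENNReal.ofReal
        (Real.exp (ζ * r) * (Real.exp (r * f ξ) * (Real.exp r - 1) ^ (-(α + 1))))) ∂σ := by
  rw [← lintegral_indicator measurableSet_ball.compl, lintegral_levyMeasure α hf σ
    (Measurable.indicator (by fun_prop) measurableSet_ball.compl)]
  refine lintegral_congr fun ξ => ?_
  have hIci : Set.Ici (1 : ℝ) = Set.Ici 1 ∩ Set.Ioi 0 :=
    (Set.inter_eq_left.2 (Set.Ici_subset_Ioi.2 one_pos)).symm
  rw [hIci, ← setLIntegral_indicator measurableSet_Ici]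
  refine setLIntegral_congr_fun measurableSet_Ioi fun r hr => ?_
  have hr0 : 0 < r := hr
  have hnorm : ‖r • (ξ : EuclideanSpace ℝ (Fin d))‖ = r := by
    rw [norm_smul, norm_eq_of_mem_sphere ξ, mul_one, Real.norm_of_nonneg hr0.le]
  by_cases h1 : 1 ≤ r
  · have hmem : r • (ξ : EuclideanSpace ℝ (Fin d)) ∈ (Metric.ball 0 1)ᶜ := by
      simpa [hnorm] using h1
    simp only [Set.indicator_of_mem hmem, Set.indicator_of_mem (Set.mem_Ici.2 h1), hnorm]
    exact (ENNReal.ofReal_mul (Real.exp_pos _).le).symm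
  · have hmem : r • (ξ : EuclideanSpace ℝ (Fin d)) ∉ (Metric.ball 0 1)ᶜ := by
      simpa [hnorm] using h1
    have h1' : r ∉ Set.Ici (1 : ℝ) := h1
    simp only [Set.indicator_of_notMem hmem, Set.indicator_of_notMem h1', zero_mul]

theorem lintegral_exp_norm_compl_ball_levyMeasure_lt_top [IsFiniteMeasure σ] (hα : 0 < α)
    (hf : Measurable f) (hb : BddAbove (Set.range f)) {ζ : ℝ} (hζ : ζ < α + 1 - ⨆ ξ, f ξ) :
    ∫⁻ x in (Metric.ball 0 1)ᶜ, ENNReal.ofReal (Real.exp (ζ * ‖x‖)) ∂(levyMeasure α f σ) <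
      ⊤ := by
  rw [lintegral_exp_norm_compl_ball_levyMeasure hf]
  set γ := ⨆ ξ, f ξ with hγ
  set c : ℝ := (1 - Real.exp (-1)) ^ (-(α + 1)) with hc
  have hc1 : 0 < 1 - Real.exp (-1) := by simp
  have hint : IntegrableOn (fun r : ℝ => c * Real.exp (-(α + 1 - γ - ζ) * r)) (Set.Ici 1) :=
    ((integrableOn_Ici_iff_integrableOn_Ioi (by simp)).2
      (integrableOn_exp_mul_Ioi (by linarith) 1)).const_mul _
  refine lt_of_le_of_lt (lintegral_mono (g := fun _ => ∫⁻ r in Set.Ici (1 : ℝ),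
    ENNReal.ofReal (c * Real.exp (-(α + 1 - γ - ζ) * r))) fun ξ => ?_) ?_
  · refine setLIntegral_mono' measurableSet_Ici fun r hr => ENNReal.ofReal_le_ofReal ?_
    have hr1 : 1 ≤ r := hr
    have hfξ : f ξ ≤ γ := le_ciSup hb ξ
    have hre : (1 - Real.exp (-1)) * Real.exp r ≤ Real.exp r - 1 := by
      have : 1 ≤ Real.exp (-1) * Real.exp r := by
        rw [← Real.exp_add]
        exact Real.one_le_exp (by linarith)
      linarith
    have hpow : (Real.exp r - 1) ^ (-(α + 1)) ≤ c * Real.exp (r * (-(α + 1))) := by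
      rw [hc, Real.exp_mul, ← Real.mul_rpow hc1.le (Real.exp_pos r).le]
      exact Real.rpow_le_rpow_of_nonpos (by positivity) hre (by linarith)
    have hpow0 : 0 ≤ (Real.exp r - 1) ^ (-(α + 1)) :=
      Real.rpow_nonneg (by linarith [Real.add_one_le_exp r]) _
    calc _ ≤ Real.exp (ζ * r) * (Real.exp (r * γ) * (c * Real.exp (r * (-(α + 1))))) := by
          gcongr
      _ = c * (Real.exp (ζ * r) * Real.exp (r * γ) * Real.exp (r * (-(α + 1)))) := by ring
      _ = _ := by
          rw [← Real.exp_add, ← Real.exp_add]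
          ring_nf
  · rw [lintegral_const]
    exact ENNReal.mul_lt_top hint.setLIntegral_lt_top (measure_lt_top σ _)

/-- For constant `f`, the radial density is at least `e^{(κ - α - 1) r}`, so the critical
exponential already makes the integrand at least `1` on `[1, ∞)`. -/
theorem lintegral_exp_norm_compl_ball_levyMeasure_eq_top (hσ : σ ≠ 0) (hα : 0 < α) {κ : ℝ}
    (hκ : ∀ ξ, f ξ = κ) {ζ : ℝ} (hζ : α + 1 - κ ≤ ζ) :
    ∫⁻ x in (Metric.ball 0 1)ᶜ, ENNReal.ofReal (Real.exp (ζ * ‖x‖)) ∂(levyMeasure α f σ) =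
      ⊤ := by
  have hf : Measurable f := by
    rw [funext hκ]
    exact measurable_const
  rw [lintegral_exp_norm_compl_ball_levyMeasure hf]
  refine eq_top_mono (lintegral_mono (f := fun _ => ⊤) fun ξ => ?_)
    (by rw [lintegral_const, ENNReal.top_mul (Measure.measure_univ_ne_zero.2 hσ)])
  calc (⊤ : ℝ≥0∞) = ∫⁻ r in Set.Ici (1 : ℝ), 1 := by simp
    _ ≤ _ := setLIntegral_mono' measurableSet_Ici fun r hr => ?_
  have hr1 : 1 ≤ r := hr
  have hpos : 0 < Real.exp r - 1 := by linarith [Real.add_one_le_exp r]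
  have hpow : Real.exp (r * (-(α + 1))) ≤ (Real.exp r - 1) ^ (-(α + 1)) := by
    rw [Real.exp_mul]
    exact Real.rpow_le_rpow_of_nonpos hpos (by linarith) (by linarith)
  rw [hκ ξ, ENNReal.one_le_ofReal]
  calc (1 : ℝ) ≤ Real.exp ((ζ - (α + 1 - κ)) * r) :=
        Real.one_le_exp (mul_nonneg (by linarith) (by linarith))
    _ = Real.exp (ζ * r) * (Real.exp (r * κ) * Real.exp (r * (-(α + 1)))) := by
        rw [← Real.exp_add, ← Real.exp_add]
        ring_nf
    _ ≤ _ := by gcongr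

theorem IsLampertiStable.lintegral_exp_norm_lt_top
    {μ : Measure (EuclideanSpace ℝ (Fin d))} (hμ : IsLampertiStable α f σ μ) {ζ : ℝ}
    (hζ : ζ < α + 1 - ⨆ ξ, f ξ) : ∫⁻ x, ENNReal.ofReal (Real.exp (ζ * ‖x‖)) ∂μ < ⊤ := by
  have := hμ.isFiniteMeasure
  obtain ⟨b, hb⟩ := hμ.hasLevyTriplet
  -- Negative exponents are dominated by `0`, which is itself subcritical.
  have hmax : max ζ 0 < α + 1 - ⨆ ξ, f ξ := max_lt hζ (by linarith [hμ.iSup_lt])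
  refine lt_of_le_of_lt (lintegral_mono fun x => ENNReal.ofReal_le_ofReal
    (Real.exp_le_exp.2 (mul_le_mul_of_nonneg_right (le_max_left ζ 0) (norm_nonneg x))))
    (hb.lintegral_exp_norm_lt_top (le_max_right ζ 0)
      (lintegral_exp_norm_compl_ball_levyMeasure_lt_top hμ.index_pos hμ.measurable
        hμ.bddAbove hmax))

theorem rpow_le_mul_exp {p δ t : ℝ} (hp : 0 < p) (hδ : 0 < δ) (ht : 0 ≤ t) :
    t ^ p ≤ (p / δ) ^ p * Real.exp (δ * t) := by
  have h1 : δ * t / p ≤ Real.exp (δ * t / p) := by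
    linarith [Real.add_one_le_exp (δ * t / p)]
  calc t ^ p = (p / δ * (δ * t / p)) ^ p := by
        congr 1
        field_simp
    _ = (p / δ) ^ p * (δ * t / p) ^ p := Real.mul_rpow (by positivity) (by positivity)
    _ ≤ (p / δ) ^ p * Real.exp (δ * t / p) ^ p := by gcongr
    _ = (p / δ) ^ p * Real.exp (δ * t) := by
        rw [← Real.exp_mul, div_mul_cancel₀ _ hp.ne']

end LampertiStable

theorem proposition1 {d : ℕ} (α : ℝ)
    (f : Metric.sphere (0 : EuclideanSpace ℝ (Fin d)) 1 → ℝ)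
    (σ : MeasureTheory.Measure (Metric.sphere (0 : EuclideanSpace ℝ (Fin d)) 1))
    (μ : MeasureTheory.Measure (EuclideanSpace ℝ (Fin d)))
    (hμ : LampertiStable.IsLampertiStable α f σ μ) :
    (∀ p : ℝ, 0 < p → ∫⁻ x, ENNReal.ofReal (‖x‖ ^ p) ∂μ < ⊤) ∧
    (∀ ζ : ℝ, ζ < α + 1 - (⨆ ξ, f ξ) →
      ∫⁻ x, ENNReal.ofReal (Real.exp (ζ * ‖x‖)) ∂μ < ⊤) ∧
    (∀ κ : ℝ, (∀ ξ, f ξ = κ) → ∀ ζ : ℝ,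
      (∫⁻ x, ENNReal.ofReal (Real.exp (ζ * ‖x‖)) ∂μ < ⊤ ↔ ζ < α + 1 - κ)) := by
  refine ⟨fun p hp => ?_, fun ζ hζ => hμ.lintegral_exp_norm_lt_top hζ, fun κ hκ ζ => ?_⟩
  · obtain ⟨δ, hδ0, hδ⟩ := exists_between (sub_pos.2 hμ.iSup_lt)
    refine lt_of_le_of_lt (MeasureTheory.lintegral_mono fun x => ENNReal.ofReal_le_ofReal
      (LampertiStable.rpow_le_mul_exp hp hδ0 (norm_nonneg x))) ?_
    simp_rw [ENNReal.ofReal_mul (show 0 ≤ (p / δ) ^ p by positivity)]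
    rw [MeasureTheory.lintegral_const_mul _ (by fun_prop)]
    exact ENNReal.mul_lt_top ENNReal.ofReal_lt_top (hμ.lintegral_exp_norm_lt_top hδ)
  · -- `σ ≠ 0` forces the sphere to be nonempty, so that the supremum of `f` is `κ`.
    have hne : Nonempty (Metric.sphere (0 : EuclideanSpace ℝ (Fin d)) 1) := by
      by_contra hempty
      have := not_nonempty_iff.1 hempty
      exact hμ.ne_zero (MeasureTheory.Measure.eq_zero_of_isEmpty σ)
    have hsup : ⨆ ξ, f ξ = κ := by
      rw [funext hκ, ciSup_const]
    refine ⟨fun h => ?_, fun hζ => hμ.lintegral_exp_norm_lt_top (by rwa [hsup])⟩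
    by_contra! hζ
    have hκlt := hμ.iSup_lt
    rw [hsup] at hκlt
    obtain ⟨b, hb⟩ := hμ.hasLevyTriplet
    exact ((hb.lintegral_exp_norm_lt_top_iff (by linarith)).1 h).ne
      (LampertiStable.lintegral_exp_norm_compl_ball_levyMeasure_eq_top hμ.ne_zero
        hμ.index_pos hκ hζ)
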